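/- Let $k,d\in\mathbb N$ with $1\le k\le d$. A real-valued stochastic process $X=\{X_t\}_{t\in\mathbb R^d}$ is called max-stable if for all $m\in\mathbb N$ and $t_1,\dots,t_m\in\mathbb R^d$ there are sequences $(a_n)_{n\ge1}$ and $(b_n)_{n\ge1}$ in $\mathbb R^m$ with $a_n>0$ (componentwise) such that, for every $n\ge 1$, if $Y^{(1)},\dots,Y^{(n)}$ are independent copies of $Y=(X_{t_1},\dots,X_{t_m})$, then $\max_{i\le n}Y^{(i)}$ has the same distribution as $a_nY+b_n$ (all operations componentwise). It is stationary if its finite-dimensional distributions are invariant under translations of $\mathbb R^d$, and it has standard Fréchet marginals if $\mathbb P(X_t\le x)=e^{-1/x}$ for all $t\in\mathbb R^d$ and $x>0$. A function $\chi:\mathbb R^d\to\mathbb R$ is called a tail correlation function (TCF) on $\mathbb R^d$ if there is a stationary max-stable process $X$ on $\mathbb R^d$ with standard Fréchet marginals such that $$\chi(t)=\lim_{\tau\to\infty}\mathbb P(X_t\ge\tau\mid X_o\ge\tau)\qquad\text{for all } t\in\mathbb R^d,$$ where $o$ is the origin. Let $V_k(\mathbb R^d)=\{A\in\mathbb R^{d\times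 k}: A^{\top}A=\mathbf 1_{k\times k}\}$ be the Stiefel manifold of orthonormal $k$-frames in $\mathbb R^d$, and let $\sigma^d_k$ be its uniform distribution, i.e. the unique Borel probability measure on $V_k(\mathbb R^d)$ that is invariant under the left action of the orthogonal group $O(d)$. For a continuous function $f:\mathbb R^k\to\mathbb R$ define $$\mathrm{TB}^d_k(f)(t)=\int_{V_k(\mathbb R^d)} f(A^{\top}t)\,\sigma^d_k(\mathrm dA),\qquad t\in\mathbb R^d.$$ **Proposition.** If $\chi$ is a continuous TCF on $\mathbb R^k$, then $\mathrm{TB}^d_k(\chi)$ is a continuous TCF on $\mathbb R^d$. -/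

import Mathlib

open MeasureTheory Filter Topology

namespace TailCorrelation

/-! ### Max-stable processes and tail correlation functions -/

section Processes

variable {d : ℕ} {Ω : Type*} [MeasurableSpace Ω]

/-- The finite-dimensional distribution of the process `X` at the points `t 0, …, t (m - 1)`,
i.e. the law of the random vector `(X_{t_1}, …, X_{t_m})`. -/
noncomputable def fdd (μ : Measure Ω) (X : EuclideanSpace ℝ (Fin d) → Ω → ℝ) {m : ℕ}
    (t : Fin m → EuclideanSpace ℝ (Fin d)) : Measure (Fin m → ℝ) :=
  μ.map (fun ω j => X (t j) ω)

/-- `X` is stationary: its finite-dimensional distributions are invariant under translations. -/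
def IsStationary (μ : Measure Ω) (X : EuclideanSpace ℝ (Fin d) → Ω → ℝ) : Prop :=
  ∀ (m : ℕ) (t : Fin m → EuclideanSpace ℝ (Fin d)) (h : EuclideanSpace ℝ (Fin d)),
    fdd μ X (fun j => t j + h) = fdd μ X t

/-- `X` is max-stable: for all points `t_1, …, t_m` there are norming sequences `a_n > 0` and `b_n`
in `ℝ^m` such that, for every `n ≥ 1`, the componentwise maximum of `n` independent copies of
`Y = (X_{t_1}, …, X_{t_m})` has the same law as `a_n Y + b_n` (componentwise operations). The `n`
independent copies are the coordinates of the `n`-fold product of the law of `Y`. -/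
def IsMaxStable (μ : Measure Ω) (X : EuclideanSpace ℝ (Fin d) → Ω → ℝ) : Prop :=
  ∀ (m : ℕ) (t : Fin m → EuclideanSpace ℝ (Fin d)),
    ∃ a b : ℕ → Fin m → ℝ, (∀ n j, 0 < a n j) ∧
      ∀ n : ℕ, 1 ≤ n →
        (Measure.pi fun _ : Fin n => fdd μ X t).map
            (fun (y : Fin n → Fin m → ℝ) (j : Fin m) => ⨆ i : Fin n, y i j) =
          (fdd μ X t).map (fun (y : Fin m → ℝ) (j : Fin m) => a n j * y j + b n j)

/-- `X` has standard Fréchet marginals: `P(X_t ≤ x) = exp(-1/x)` for all `t` and all `x > 0`. -/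
def HasFrechetMarginals (μ : Measure Ω) (X : EuclideanSpace ℝ (Fin d) → Ω → ℝ) : Prop :=
  ∀ (t : EuclideanSpace ℝ (Fin d)) (x : ℝ), 0 < x →
    μ.real {ω | X t ω ≤ x} = Real.exp (-(1 / x))

/-- `χ` is the tail correlation function of the process `X` (whose one-dimensional marginal
distributions have upper endpoint `∞`): for every `t`, the conditional probability
`P(X_t ≥ τ | X_0 ≥ τ)` tends to `χ t` as `τ → ∞`. -/
def IsTCFOf (μ : Measure Ω) (X : EuclideanSpace ℝ (Fin d) → Ω → ℝ)
    (χ : EuclideanSpace ℝ (Fin d) → ℝ) : Prop :=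
  ∀ t : EuclideanSpace ℝ (Fin d),
    Tendsto (fun τ : ℝ => (ProbabilityTheory.cond μ {ω | τ ≤ X 0 ω}).real {ω | τ ≤ X t ω})
      atTop (𝓝 (χ t))

end Processes

/-- `χ` is a tail correlation function on `ℝ^d`: it is the tail correlation function of some
stationary max-stable process on `ℝ^d` with standard Fréchet marginals. -/
def IsTCF (d : ℕ) (χ : EuclideanSpace ℝ (Fin d) → ℝ) : Prop :=
  ∃ (Ω : Type) (_ : MeasurableSpace Ω) (μ : Measure Ω)
    (X : EuclideanSpace ℝ (Fin d) → Ω → ℝ),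
    IsProbabilityMeasure μ ∧ (∀ t, Measurable (X t)) ∧ IsMaxStable μ X ∧ IsStationary μ X ∧
      HasFrechetMarginals μ X ∧ IsTCFOf μ X χ

/-! ### The Stiefel manifold, its uniform distribution, and the turning bands operator -/

/-- Spaces of real matrices carry the Borel `σ`-algebra. -/
instance instMeasurableSpaceMatrix (m n : ℕ) : MeasurableSpace (Matrix (Fin m) (Fin n) ℝ) :=
  borel _

instance instBorelSpaceMatrix (m n : ℕ) : BorelSpace (Matrix (Fin m) (Fin n) ℝ) := ⟨rfl⟩

/-- The orthogonal group `O(d)` is compact. -/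
instance instCompactSpaceOrthogonalGroup (d : ℕ) :
    CompactSpace (Matrix.orthogonalGroup (Fin d) ℝ) := by
  have hK : IsCompact {A : Matrix (Fin d) (Fin d) ℝ | ∀ i j, A i j ∈ Set.Icc (-1 : ℝ) 1} := by
    have h : IsCompact (Set.univ.pi fun _ : Fin d => Set.univ.pi fun _ : Fin d =>
        Set.Icc (-1 : ℝ) 1) :=
      isCompact_univ_pi fun _ => isCompact_univ_pi fun _ => isCompact_Icc
    simpa only [Set.pi, Set.mem_univ, true_imp_iff] using! h
  have hc : IsClosed {A : Matrix (Fin d) (Fin d) ℝ | A * A.transpose = 1} :=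
    isClosed_eq (continuous_id.matrix_mul continuous_id.matrix_transpose) continuous_const
  have hs : {A : Matrix (Fin d) (Fin d) ℝ | A * A.transpose = 1} =
      (Matrix.orthogonalGroup (Fin d) ℝ : Set (Matrix (Fin d) (Fin d) ℝ)) := by
    ext A
    exact (Matrix.mem_orthogonalGroup_iff _ _).symm
  rw [hs] at hc
  exact isCompact_iff_compactSpace.mp (hK.of_isClosed_subset hc fun A hA i j =>
    abs_le.mp (entry_norm_bound_of_unitary (𝕜 := ℝ) hA i j))

/-- The normalized Haar measure on the orthogonal group `O(d)`. -/
noncomputable def orthogonalHaar (d : ℕ) : Measure (Matrix.orthogonalGroup (Fin d) ℝ) :=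
  Measure.haarMeasure ⊤

/-- The Stiefel manifold `V_k(ℝ^d)` of real `d × k` matrices `A` with `Aᵀ A = 1`. -/
def Stiefel (k d : ℕ) : Set (Matrix (Fin d) (Fin k) ℝ) :=
  {A | A.transpose * A = 1}

/-- The matrix whose columns are the first `k` standard basis vectors of `ℝ^d`, as an element of
`V_k(ℝ^d)` for `k ≤ d`. -/
def standardFrame {k d : ℕ} (hkd : k ≤ d) : Stiefel k d :=
  ⟨(1 : Matrix (Fin d) (Fin d) ℝ).submatrix id (Fin.castLE hkd), by
    ext i j
    simp [Matrix.mul_apply, Matrix.one_apply, eq_comm]⟩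

/-- The left action of `O(d)` on `V_k(ℝ^d)`. -/
def rotate {k d : ℕ} (G : Matrix.orthogonalGroup (Fin d) ℝ) (A : Stiefel k d) : Stiefel k d :=
  ⟨(G : Matrix (Fin d) (Fin d) ℝ) * (A : Matrix (Fin d) (Fin k) ℝ), by
    have hG : (G : Matrix (Fin d) (Fin d) ℝ).transpose * (G : Matrix (Fin d) (Fin d) ℝ) = 1 :=
      (Matrix.mem_orthogonalGroup_iff' _ _).mp G.2
    have hA : (A : Matrix (Fin d) (Fin k) ℝ).transpose * (A : Matrix (Fin d) (Fin k) ℝ) = 1 := A.2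
    change _ = _
    rw [Matrix.transpose_mul, Matrix.mul_assoc, ← Matrix.mul_assoc _ _ A.1, hG, Matrix.one_mul,
      hA]⟩

/-- The uniform distribution `σ^d_k` on `V_k(ℝ^d)`, i.e. the unique Borel probability measure that
is invariant under the left action of `O(d)`. It is the image of the normalized Haar measure of
`O(d)` under the orbit map of a fixed frame. -/
noncomputable def stiefelUniform {k d : ℕ} (hkd : k ≤ d) : Measure (Stiefel k d) :=
  (orthogonalHaar d).map (fun G => rotate G (standardFrame hkd))

/-- The map `t ↦ Aᵀ t` from `ℝ^d` to `ℝ^k` (with Euclidean norms). -/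
def transposeApply {k d : ℕ} (A : Matrix (Fin d) (Fin k) ℝ) (t : EuclideanSpace ℝ (Fin d)) :
    EuclideanSpace ℝ (Fin k) :=
  WithLp.toLp 2 (A.transpose.mulVec (WithLp.ofLp t))

/-- The turning bands operator `TB^d_k(f)(t) = ∫_{V_k(ℝ^d)} f(Aᵀ t) σ^d_k(dA)`. -/
noncomputable def turningBands {k d : ℕ} (hkd : k ≤ d) (f : EuclideanSpace ℝ (Fin k) → ℝ) :
    EuclideanSpace ℝ (Fin d) → ℝ :=
  fun t => ∫ A : Stiefel k d, f (transposeApply (A : Matrix (Fin d) (Fin k) ℝ) t)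
    ∂(stiefelUniform hkd)

theorem continuous_rotate_left {k d : ℕ} (A : Stiefel k d) :
    Continuous fun G : Matrix.orthogonalGroup (Fin d) ℝ => rotate G A :=
  Continuous.subtype_mk (continuous_subtype_val.matrix_mul continuous_const) _

theorem continuous_rotate {k d : ℕ} (G : Matrix.orthogonalGroup (Fin d) ℝ) :
    Continuous (rotate G : Stiefel k d → Stiefel k d) :=
  Continuous.subtype_mk (continuous_const.matrix_mul continuous_subtype_val) _

instance instIsProbabilityMeasureOrthogonalHaar (d : ℕ) :
    IsProbabilityMeasure (orthogonalHaar d) :=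
  ⟨Measure.haarMeasure_self⟩

/-- The uniform distribution is a probability measure. -/
instance instIsProbabilityMeasureStiefelUniform {k d : ℕ} (hkd : k ≤ d) :
    IsProbabilityMeasure (stiefelUniform hkd) :=
  Measure.isProbabilityMeasure_map (continuous_rotate_left _).measurable.aemeasurable

/-- The uniform distribution is invariant under the left action of `O(d)`. -/
theorem map_rotate_stiefelUniform {k d : ℕ} (hkd : k ≤ d)
    (G : Matrix.orthogonalGroup (Fin d) ℝ) :
    (stiefelUniform hkd).map (rotate G) = stiefelUniform hkd := by
  have h : (orthogonalHaar d).map (fun H => G * H) = orthogonalHaar d := by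
    unfold orthogonalHaar
    exact map_mul_left_eq_self _ G
  unfold stiefelUniform
  conv_rhs => rw [← h]
  rw [Measure.map_map (continuous_rotate G).measurable (continuous_rotate_left _).measurable,
    Measure.map_map (continuous_rotate_left _).measurable (continuous_const_mul G).measurable]
  congr 1
  funext H
  exact Subtype.ext (Matrix.mul_assoc _ _ _).symm

end TailCorrelation

/-! The function `turningBands hkd χ` is an average of the functions `t ↦ χ (Aᵀ t)`. Each of these
is a TCF, realised by the process `t ↦ X (Aᵀ t)`, so it suffices that TCFs form a convex set that is
closed under pointwise convergence (`convex_setOf_isTCF`, `isClosed_setOf_isTCF`,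
`turningBands_mem_closure`).

The defining limit `τ → ∞` need not commute with limits of processes. Max-stability removes it: with
Fréchet marginals the norming is `a_n = n`, `b_n = 0`, which forces `P(X_0 ≤ x, X_t ≤ x) = exp(-(2 -
χ t) / x)` at every level `x > 0`. Being a TCF thus becomes a system of equations between joint
distribution functions at positive levels (`isTCF_iff`).

Convexity then follows from `max (a X) (b X')` with independent `X`, `X'`, whose exponents add. For
closedness, the laws are placed on the compact space of `EReal`-valued functions, where an
ultrafilter limit exists by the Riesz representation theorem; the fixed Fréchet marginals exclude
mass at infinity and atoms at positive levels, so joint distribution functions converge. -/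

namespace TailCorrelation

/-! ### Joint distribution functions of max-stable processes -/

section Model

variable {d : ℕ} {Ω : Type*} [MeasurableSpace Ω]

/-- The joint distribution function of `X` at the points `t 0, …, t (m - 1)`. -/
noncomputable def jointCdf (μ : Measure Ω) (X : EuclideanSpace ℝ (Fin d) → Ω → ℝ) {m : ℕ}
    (t : Fin m → EuclideanSpace ℝ (Fin d)) (x : Fin m → ℝ) : ℝ :=
  μ.real {ω | ∀ j, X (t j) ω ≤ x j}

/-- The description, in terms of joint distribution functions on the positive orthant, of a
stationary max-stable process with standard Fréchet marginals and tail correlation function `χ`. -/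
structure IsFrechetModel (μ : Measure Ω) (X : EuclideanSpace ℝ (Fin d) → Ω → ℝ)
    (χ : EuclideanSpace ℝ (Fin d) → ℝ) : Prop where
  measurable : ∀ t, Measurable (X t)
  marginals : HasFrechetMarginals μ X
  stationary : ∀ (m : ℕ) (t : Fin m → EuclideanSpace ℝ (Fin d)) (h : EuclideanSpace ℝ (Fin d))
    (x : Fin m → ℝ), (∀ j, 0 < x j) → jointCdf μ X (fun j => t j + h) x = jointCdf μ X t x
  maxStable : ∀ (m : ℕ) (t : Fin m → EuclideanSpace ℝ (Fin d)) (x : Fin m → ℝ) (n : ℕ),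
    (∀ j, 0 < x j) → 1 ≤ n → jointCdf μ X t (fun j => n * x j) ^ n = jointCdf μ X t x
  tail : ∀ (t : EuclideanSpace ℝ (Fin d)) (x : ℝ), 0 < x →
    jointCdf μ X ![0, t] (fun _ => x) = Real.exp (-((2 - χ t) / x))

theorem jointCdf_singleton (μ : Measure Ω) (X : EuclideanSpace ℝ (Fin d) → Ω → ℝ)
    (t : EuclideanSpace ℝ (Fin d)) (x : ℝ) :
    jointCdf μ X ![t] (fun _ => x) = μ.real {ω | X t ω ≤ x} := by
  simp [jointCdf]

theorem jointCdf_pair (μ : Measure Ω) (X : EuclideanSpace ℝ (Fin d) → Ω → ℝ)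
    (s t : EuclideanSpace ℝ (Fin d)) (x : ℝ) :
    jointCdf μ X ![s, t] (fun _ => x) = μ.real {ω | X s ω ≤ x ∧ X t ω ≤ x} := by
  simp [jointCdf, Fin.forall_fin_two]

/-- The marginal hypothesis concerns positive levels only; monotonicity and `exp (-1/y) → 0` as `y ↓
0` settle the others. -/
theorem HasFrechetMarginals.real_le_eq_zero {μ : Measure Ω} [IsFiniteMeasure μ]
    {X : EuclideanSpace ℝ (Fin d) → Ω → ℝ} (hF : HasFrechetMarginals μ X)
    (t : EuclideanSpace ℝ (Fin d)) {x : ℝ} (hx : x ≤ 0) : μ.real {ω | X t ω ≤ x} = 0 := by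
  refine le_antisymm ?_ measureReal_nonneg
  have hlim : Tendsto (fun y : ℝ => Real.exp (-(1 / y))) (𝓝[>] 0) (𝓝 0) := by
    simp only [one_div]
    exact Real.tendsto_exp_neg_atTop_nhds_zero.comp tendsto_inv_nhdsGT_zero
  refine ge_of_tendsto hlim ?_
  filter_upwards [self_mem_nhdsWithin] with y hy
  rw [← hF t y hy]
  exact measureReal_mono fun ω hω => le_trans hω (hx.trans (le_of_lt hy))

theorem HasFrechetMarginals.real_le_pos {μ : Measure Ω}
    {X : EuclideanSpace ℝ (Fin d) → Ω → ℝ} (hF : HasFrechetMarginals μ X)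
    (t : EuclideanSpace ℝ (Fin d)) {x : ℝ} (hx : 0 < x) : 0 < μ.real {ω | X t ω ≤ x} := by
  rw [hF t x hx]
  exact Real.exp_pos _

theorem HasFrechetMarginals.real_eq_eq_zero {μ : Measure Ω} [IsFiniteMeasure μ]
    {X : EuclideanSpace ℝ (Fin d) → Ω → ℝ} (hX : ∀ t, Measurable (X t))
    (hF : HasFrechetMarginals μ X) (t : EuclideanSpace ℝ (Fin d)) {x : ℝ} (hx : 0 < x) :
    μ.real {ω | X t ω = x} = 0 := by
  refine le_antisymm ?_ measureReal_nonneg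
  have hlim : Tendsto (fun y : ℝ => Real.exp (-(1 / x)) - Real.exp (-(1 / y))) (𝓝[<] x) (𝓝 0) := by
    have : ContinuousAt (fun y : ℝ => Real.exp (-(1 / x)) - Real.exp (-(1 / y))) x := by
      have := hx.ne'
      fun_prop (disch := assumption)
    simpa using this.tendsto.mono_left nhdsWithin_le_nhds
  refine ge_of_tendsto hlim ?_
  filter_upwards [self_mem_nhdsWithin, mem_nhdsWithin_of_mem_nhds (lt_mem_nhds hx)] with y hy hy0
  rw [← hF t y hy0, ← hF t x hx, ← measureReal_sdiff]
  · refine measureReal_mono fun ω hω => ?_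
    simp only [Set.mem_ofPred_eq] at hω
    simpa [hω] using hy
  · exact fun ω (hω : X t ω ≤ y) => hω.trans (le_of_lt hy)
  · exact measurableSet_le (hX t) measurable_const

/-- Max-stability, evaluated on the event that the coordinates in `J` are bounded. -/
theorem map_iSup_pi_real_forall_le {μ : Measure Ω} [IsProbabilityMeasure μ]
    {X : EuclideanSpace ℝ (Fin d) → Ω → ℝ} (hX : ∀ t, Measurable (X t)) {m : ℕ}
    (t : Fin m → EuclideanSpace ℝ (Fin d)) (n : ℕ) (hn : 1 ≤ n) (J : Set (Fin m)) (x : Fin m → ℝ) :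
    ((Measure.pi fun _ : Fin n => fdd μ X t).map
      (fun (y : Fin n → Fin m → ℝ) (j : Fin m) => ⨆ i : Fin n, y i j)).real
        {y | ∀ j ∈ J, y j ≤ x j} = μ.real {ω | ∀ j ∈ J, X (t j) ω ≤ x j} ^ n := by
  have : Nonempty (Fin n) := ⟨⟨0, hn⟩⟩
  have hm : Measurable fun ω j => X (t j) ω := measurable_pi_lambda _ fun j => hX _
  have hS : MeasurableSet {y : Fin m → ℝ | ∀ j ∈ J, y j ≤ x j} := by
    simp only [Set.ofPred_forall]
    exact MeasurableSet.iInter fun j => MeasurableSet.iInter fun _ =>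
      measurableSet_le (measurable_pi_apply j) measurable_const
  have : IsProbabilityMeasure (fdd μ X t) := Measure.isProbabilityMeasure_map hm.aemeasurable
  have hsup : Measurable fun (y : Fin n → Fin m → ℝ) (j : Fin m) => ⨆ i : Fin n, y i j :=
    measurable_pi_lambda _ fun j => Measurable.iSup fun i =>
      (measurable_pi_apply j).comp (measurable_pi_apply i)
  rw [measureReal_def, Measure.map_apply hsup hS]
  have hpre : (fun (y : Fin n → Fin m → ℝ) (j : Fin m) => ⨆ i : Fin n, y i j) ⁻¹'
      {y | ∀ j ∈ J, y j ≤ x j} = Set.univ.pi fun _ => {y | ∀ j ∈ J, y j ≤ x j} := by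
    ext y
    simp only [Set.mem_preimage, Set.mem_ofPred_eq, Set.mem_pi, Set.mem_univ, true_imp_iff]
    constructor
    · exact fun h i j hj => (le_ciSup (Set.finite_range fun i => y i j).bddAbove i).trans (h j hj)
    · exact fun h j hj => ciSup_le fun i => h i j hj
  rw [hpre, Measure.pi_pi]
  simp only [Finset.prod_const, Finset.card_univ, Fintype.card_fin, ENNReal.toReal_pow]
  rw [fdd, Measure.map_apply hm hS]
  rfl

/-- The norming constants of a max-stable process with standard Fréchet marginals. -/
theorem norming_eq {μ : Measure Ω} [IsFiniteMeasure μ]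
    {X : EuclideanSpace ℝ (Fin d) → Ω → ℝ} (hF : HasFrechetMarginals μ X)
    (t : EuclideanSpace ℝ (Fin d)) {n : ℕ} (hn : 1 ≤ n) {a b : ℝ} (ha : 0 < a)
    (h : ∀ x, μ.real {ω | X t ω ≤ x} ^ n = μ.real {ω | a * X t ω + b ≤ x}) : a = n ∧ b = 0 := by
  have h' : ∀ x, μ.real {ω | X t ω ≤ x} ^ n = μ.real {ω | X t ω ≤ (x - b) / a} := by
    intro x
    rw [h x]
    congr 1
    ext ω
    simp only [Set.mem_ofPred_eq, le_div_iff₀ ha, le_sub_iff_add_le, mul_comm]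
  -- A negative `b` is refuted at level `0`, where only the right side is positive; a positive `b`
  -- at level `b`, where only the left side is.
  have hb : b = 0 := by
    rcases lt_trichotomy b 0 with hb | hb | hb
    · have h1 := h' 0
      rw [hF.real_le_eq_zero t le_rfl, zero_pow (by omega)] at h1
      have := hF.real_le_pos t (x := (0 - b) / a) (by apply div_pos <;> linarith)
      linarith
    · exact hb
    · have h1 := h' b
      rw [sub_self, zero_div, hF.real_le_eq_zero t le_rfl] at h1
      have := pow_pos (hF.real_le_pos t hb) n
      linarith
  refine ⟨?_, hb⟩
  have h1 := h' 1
  rw [hb, sub_zero, hF t 1 one_pos, hF t (1 / a) (by positivity), ← Real.exp_nat_mul,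
    Real.exp_eq_exp] at h1
  simp at h1
  linarith

theorem IsMaxStable.jointCdf_pow {μ : Measure Ω} [IsProbabilityMeasure μ]
    {X : EuclideanSpace ℝ (Fin d) → Ω → ℝ} (hX : ∀ t, Measurable (X t)) (hM : IsMaxStable μ X)
    (hF : HasFrechetMarginals μ X) {m : ℕ} (t : Fin m → EuclideanSpace ℝ (Fin d)) (x : Fin m → ℝ)
    {n : ℕ} (hn : 1 ≤ n) :
    jointCdf μ X t (fun j => n * x j) ^ n = jointCdf μ X t x := by
  obtain ⟨a, b, ha, hab⟩ := hM m t
  have hm : Measurable fun ω j => X (t j) ω := measurable_pi_lambda _ fun j => hX _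
  have key : ∀ (J : Set (Fin m)) (x : Fin m → ℝ), μ.real {ω | ∀ j ∈ J, X (t j) ω ≤ x j} ^ n =
      μ.real {ω | ∀ j ∈ J, a n j * X (t j) ω + b n j ≤ x j} := by
    intro J x
    have hS : MeasurableSet {y : Fin m → ℝ | ∀ j ∈ J, y j ≤ x j} := by
      simp only [Set.ofPred_forall]
      exact MeasurableSet.iInter fun j => MeasurableSet.iInter fun _ =>
        measurableSet_le (measurable_pi_apply j) measurable_const
    have haff : Measurable fun (y : Fin m → ℝ) (j : Fin m) => a n j * y j + b n j := by fun_prop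
    rw [← map_iSup_pi_real_forall_le hX t n hn, hab n hn, measureReal_def,
      Measure.map_apply haff hS, fdd, Measure.map_apply hm (haff hS)]
    rfl
  -- Singletons `J` isolate the marginals, which already determine the norming constants.
  have hc : ∀ j, a n j = n ∧ b n j = 0 := fun j =>
    norming_eq hF (t j) hn (ha n j) fun c => by simpa using key {j} fun _ => c
  have := key Set.univ fun j => n * x j
  have hn0 : (0 : ℝ) < n := by exact_mod_cast hn
  simp only [Set.mem_univ, true_imp_iff, (hc _).1, (hc _).2, add_zero,
    mul_le_mul_iff_of_pos_left hn0] at this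
  exact this

/-- The conditional exceedance probability in terms of the distribution functions. -/
theorem cond_real_eq {μ : Measure Ω} [IsProbabilityMeasure μ]
    {X : EuclideanSpace ℝ (Fin d) → Ω → ℝ} (hX : ∀ t, Measurable (X t))
    (hF : HasFrechetMarginals μ X) (t : EuclideanSpace ℝ (Fin d)) {x : ℝ} (hx : 0 < x) :
    (ProbabilityTheory.cond μ {ω | x ≤ X 0 ω}).real {ω | x ≤ X t ω} =
      2 - (1 - jointCdf μ X ![0, t] (fun _ => x)) / (1 - Real.exp (-(1 / x))) := by
  have hle : ∀ s, MeasurableSet {ω | X s ω ≤ x} := fun s =>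
    measurableSet_le (hX s) measurable_const
  -- The two events differ only on `{X s = x}`, which is null because the Fréchet law has no atoms.
  have hae : ∀ s, ({ω | x ≤ X s ω} : Set Ω) =ᵐ[μ] ({ω | X s ω ≤ x}ᶜ : Set Ω) := by
    intro s
    have h0 : μ {ω | X s ω = x} = 0 := by
      simpa [measureReal_eq_zero_iff] using hF.real_eq_eq_zero hX s hx
    filter_upwards [measure_eq_zero_iff_ae_notMem.mp h0] with ω hω
    have hω' : X s ω ≠ x := hω
    apply propext
    change x ≤ X s ω ↔ ¬ X s ω ≤ x
    rw [not_le]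
    exact ⟨fun h => lt_of_le_of_ne h hω'.symm, le_of_lt⟩
  have hpos : 0 < 1 - Real.exp (-(1 / x)) := by
    have : Real.exp (-(1 / x)) < 1 := Real.exp_lt_one_iff.mpr (by simpa using hx)
    linarith
  rw [measureReal_def, ProbabilityTheory.cond_apply (measurableSet_le measurable_const (hX 0)),
    ENNReal.toReal_mul, ENNReal.toReal_inv, ← measureReal_def, ← measureReal_def,
    measureReal_congr (hae 0), measureReal_congr ((hae 0).inter (hae t)), jointCdf_pair,
    ← Set.compl_union, probReal_compl_eq_one_sub (hle 0),
    probReal_compl_eq_one_sub ((hle 0).union (hle t)), hF 0 x hx]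
  have hu := measureReal_union_add_inter (μ := μ) (s := {ω | X 0 ω ≤ x}) (hle t)
  rw [hF 0 x hx, hF t x hx] at hu
  have hi : {ω | X 0 ω ≤ x} ∩ {ω | X t ω ≤ x} = {ω | X 0 ω ≤ x ∧ X t ω ≤ x} := rfl
  rw [hi] at hu
  field_simp
  linarith

/-- With `s = 1 / τ`, numerator and denominator divided by `s` tend to the derivatives at `0` of `1
- exp (-c s)` and `1 - exp (-s)`. -/
theorem tendsto_one_sub_exp_div (c : ℝ) :
    Tendsto (fun τ : ℝ => (1 - Real.exp (-(c / τ))) / (1 - Real.exp (-(1 / τ)))) atTop (𝓝 c) := by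
  have hslope : ∀ c : ℝ, Tendsto (fun τ : ℝ => τ * (1 - Real.exp (-(c / τ)))) atTop (𝓝 c) := by
    intro c
    have hd : HasDerivAt (fun s : ℝ => 1 - Real.exp (-(c * s))) c 0 := by
      have h1 : HasDerivAt (fun s : ℝ => -(c * s)) (-(c * 1)) 0 :=
        ((hasDerivAt_id (0 : ℝ)).const_mul c).neg
      simpa using h1.exp.const_sub 1
    have h2 := (hasDerivAt_iff_tendsto_slope_zero.mp hd).comp
      ((tendsto_inv_atTop_nhdsGT_zero (𝕜 := ℝ)).mono_right
        (nhdsWithin_mono _ fun x (hx : 0 < x) => ne_of_gt hx))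
    refine h2.congr fun τ => ?_
    simp [div_eq_mul_inv]
  have h := (hslope c).div (hslope 1) one_ne_zero
  rw [div_one] at h
  refine h.congr' ?_
  filter_upwards [eventually_gt_atTop 0] with τ hτ
  simp only [Pi.div_apply]
  rw [mul_div_mul_left _ _ hτ.ne']

/-- Max-stability gives `H (n x) ^ n = H x`, hence `H (n x) = exp (-c / (n x))` with `c = -x log (H
x)`. The tail limit along the levels `n x` identifies `c` with `2 - χ t`. -/
theorem IsTCFOf.jointCdf_eq {μ : Measure Ω} [IsProbabilityMeasure μ]
    {X : EuclideanSpace ℝ (Fin d) → Ω → ℝ} {χ : EuclideanSpace ℝ (Fin d) → ℝ}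
    (hX : ∀ t, Measurable (X t)) (hM : IsMaxStable μ X)
    (hF : HasFrechetMarginals μ X) (hχ : IsTCFOf μ X χ) (t : EuclideanSpace ℝ (Fin d)) {x : ℝ}
    (hx : 0 < x) : jointCdf μ X ![0, t] (fun _ => x) = Real.exp (-((2 - χ t) / x)) := by
  set H : ℝ → ℝ := fun y => jointCdf μ X ![0, t] (fun _ => y) with hH
  have hpow : ∀ n : ℕ, 1 ≤ n → H (n * x) ^ n = H x := fun n hn =>
    hM.jointCdf_pow hX hF ![0, t] (fun _ => x) hn
  have hH0 : ∀ y, 0 ≤ H y := fun y => measureReal_nonneg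
  have hlim : Tendsto (fun τ : ℝ => (1 - H τ) / (1 - Real.exp (-(1 / τ)))) atTop
      (𝓝 (2 - χ t)) := by
    refine ((hχ t).const_sub 2).congr' ?_
    filter_upwards [eventually_gt_atTop 0] with τ hτ
    rw [cond_real_eq hX hF t hτ]
    ring
  have hseq : Tendsto (fun n : ℕ => (n : ℝ) * x) atTop atTop :=
    tendsto_natCast_atTop_atTop.atTop_mul_const hx
  have hnum : Tendsto (fun τ : ℝ => 1 - Real.exp (-(1 / τ))) atTop (𝓝 0) := by
    have h1 : Tendsto (fun τ : ℝ => -(1 / τ)) atTop (𝓝 0) := by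
      simpa using (tendsto_inv_atTop_zero (𝕜 := ℝ)).neg
    simpa using ((Real.continuous_exp.tendsto 0).comp h1).const_sub 1
  have hone : Tendsto H atTop (𝓝 1) := by
    have h1 := (hlim.mul hnum).const_sub 1
    rw [mul_zero, sub_zero] at h1
    refine h1.congr' ?_
    filter_upwards [eventually_gt_atTop 0] with τ hτ
    have : Real.exp (-(1 / τ)) < 1 := Real.exp_lt_one_iff.mpr (by simpa using hτ)
    rw [div_mul_cancel₀ _ (by linarith)]
    ring
  -- The logarithm needs `H x > 0`: since `H → 1`, some `H (n x)` is positive, and `H x` is its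
  -- `n`-th power.
  have hpos : 0 < H x := by
    have h1 : ∀ᶠ n : ℕ in atTop, 0 < H (n * x) :=
      (hone.comp hseq).eventually (lt_mem_nhds zero_lt_one)
    obtain ⟨n, hn1, hn⟩ := (h1.and (eventually_ge_atTop 1)).exists
    rw [← hpow n hn]
    exact pow_pos hn1 n
  set c : ℝ := -(x * Real.log (H x)) with hc
  have hlim' : Tendsto (fun n : ℕ => (1 - H (n * x)) / (1 - Real.exp (-(1 / (n * x))))) atTop
      (𝓝 c) := by
    refine ((tendsto_one_sub_exp_div c).comp hseq).congr' ?_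
    filter_upwards [eventually_ge_atTop 1] with n hn
    have hn0 : (n : ℝ) ≠ 0 := by positivity
    have : Real.exp (-(c / (n * x))) = H (n * x) := by
      refine (pow_left_inj₀ (Real.exp_pos _).le (hH0 _) (by omega : n ≠ 0)).mp ?_
      rw [hpow n hn, ← Real.exp_nat_mul]
      rw [show (n : ℝ) * -(c / (n * x)) = Real.log (H x) by rw [hc]; field_simp]
      exact Real.exp_log hpos
    simp only [Function.comp_apply, this]
  have hcc : 2 - χ t = c := tendsto_nhds_unique (hlim.comp hseq) hlim'
  rw [hcc, show -(c / x) = Real.log (H x) by rw [hc]; field_simp, Real.exp_log hpos]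

theorem fdd_real_forall_le {μ : Measure Ω} {X : EuclideanSpace ℝ (Fin d) → Ω → ℝ}
    (hX : ∀ t, Measurable (X t)) {m : ℕ}
    (t : Fin m → EuclideanSpace ℝ (Fin d)) (x : Fin m → ℝ) :
    (fdd μ X t).real {y | ∀ j, y j ≤ x j} = jointCdf μ X t x := by
  rw [fdd, map_measureReal_apply (measurable_pi_lambda _ fun j => hX _)]
  · rfl
  · rw [Set.ofPred_forall]
    exact MeasurableSet.iInter fun j => measurableSet_le (measurable_pi_apply j) measurable_const

theorem isFrechetModel_of_isTCFOf {μ : Measure Ω} [IsProbabilityMeasure μ]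
    {X : EuclideanSpace ℝ (Fin d) → Ω → ℝ} {χ : EuclideanSpace ℝ (Fin d) → ℝ}
    (hX : ∀ t, Measurable (X t)) (hM : IsMaxStable μ X) (hS : IsStationary μ X)
    (hF : HasFrechetMarginals μ X) (hχ : IsTCFOf μ X χ) : IsFrechetModel μ X χ where
  measurable := hX
  marginals := hF
  stationary m t h x _ := by
    rw [← fdd_real_forall_le hX, ← fdd_real_forall_le hX, hS m t h]
  maxStable m t x n _ hn := hM.jointCdf_pow hX hF t x hn
  tail t x hx := hχ.jointCdf_eq hX hM hF t hx

end Model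

/-! ### Uniqueness of laws from distribution functions -/

/-- Probability measures on `ℝ^m` are determined by their joint distribution functions. -/
theorem ext_of_forall_real_forall_le {m : ℕ} {P Q : Measure (Fin m → ℝ)} [IsProbabilityMeasure P]
    [IsProbabilityMeasure Q]
    (h : ∀ x : Fin m → ℝ, P.real {y | ∀ j, y j ≤ x j} = Q.real {y | ∀ j, y j ≤ x j}) :
    P = Q := by
  refine ext_of_generate_finite
    (Set.univ.pi '' Set.univ.pi fun _ : Fin m => Set.range (Set.Iic : ℝ → Set ℝ))
    (generateFrom_eq_pi (fun _ => ?_) fun _ => ?_).symm (IsPiSystem.pi fun _ => isPiSystem_Iic)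
    ?_ (by simp)
  · exact (borel_eq_generateFrom_Iic ℝ).symm.trans (BorelSpace.measurable_eq (α := ℝ)).symm
  · refine ⟨fun n => Set.Iic (n : ℝ), fun n => ⟨_, rfl⟩, ?_⟩
    refine Set.eq_univ_of_forall fun x => ?_
    obtain ⟨n, hn⟩ := exists_nat_ge x
    exact Set.mem_iUnion.mpr ⟨n, hn⟩
  · rintro _ ⟨s, hs, rfl⟩
    choose x hx using fun j => hs j (Set.mem_univ j)
    have hset : Set.univ.pi s = {y | ∀ j, y j ≤ x j} := by
      ext y
      simp [Set.mem_pi, ← hx]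
    rw [hset]
    exact (measureReal_eq_measureReal_iff).mp (h x)

/-- Probability measures carried by the positive orthant are determined by their joint
distribution functions there. -/
theorem ext_of_forall_pos_real_forall_le {m : ℕ} {P Q : Measure (Fin m → ℝ)}
    [IsProbabilityMeasure P] [IsProbabilityMeasure Q]
    (hP : ∀ j, P.real {y | y j ≤ 0} = 0) (hQ : ∀ j, Q.real {y | y j ≤ 0} = 0)
    (h : ∀ x : Fin m → ℝ, (∀ j, 0 < x j) →
      P.real {y | ∀ j, y j ≤ x j} = Q.real {y | ∀ j, y j ≤ x j}) :
    P = Q := by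
  refine ext_of_forall_real_forall_le fun x => ?_
  by_cases hx : ∀ j, 0 < x j
  · exact h x hx
  · push Not at hx
    obtain ⟨j, hj⟩ := hx
    have hsub : {y : Fin m → ℝ | ∀ j, y j ≤ x j} ⊆ {y | y j ≤ 0} := fun y hy => (hy j).trans hj
    rw [le_antisymm ((measureReal_mono hsub).trans (hP j).le) measureReal_nonneg,
      le_antisymm ((measureReal_mono hsub).trans (hQ j).le) measureReal_nonneg]

/-! ### From distribution functions back to processes -/

section ModelToTCF

variable {d : ℕ} {Ω : Type*} [MeasurableSpace Ω] {μ : Measure Ω} [IsProbabilityMeasure μ]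
  {X : EuclideanSpace ℝ (Fin d) → Ω → ℝ} {χ : EuclideanSpace ℝ (Fin d) → ℝ}

theorem isProbabilityMeasure_fdd (hX : ∀ t, Measurable (X t)) {m : ℕ}
    (t : Fin m → EuclideanSpace ℝ (Fin d)) : IsProbabilityMeasure (fdd μ X t) :=
  Measure.isProbabilityMeasure_map (measurable_pi_lambda _ fun _ => hX _).aemeasurable

theorem fdd_real_le_zero (hX : ∀ t, Measurable (X t)) (hF : HasFrechetMarginals μ X) {m : ℕ}
    (t : Fin m → EuclideanSpace ℝ (Fin d)) (j : Fin m) : (fdd μ X t).real {y | y j ≤ 0} = 0 := by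
  rw [fdd, map_measureReal_apply (measurable_pi_lambda _ fun j => hX _)
    (measurableSet_le (measurable_pi_apply j) measurable_const)]
  exact hF.real_le_eq_zero (t j) le_rfl

theorem IsFrechetModel.isStationary (h : IsFrechetModel μ X χ) : IsStationary μ X := by
  intro m t s
  have hP : ∀ t : Fin m → EuclideanSpace ℝ (Fin d), IsProbabilityMeasure (fdd μ X t) :=
    isProbabilityMeasure_fdd h.measurable
  refine ext_of_forall_pos_real_forall_le (fdd_real_le_zero h.measurable h.marginals _)
    (fdd_real_le_zero h.measurable h.marginals _) fun x hx => ?_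
  rw [fdd_real_forall_le h.measurable, fdd_real_forall_le h.measurable, h.stationary m t s x hx]

theorem IsFrechetModel.isMaxStable (h : IsFrechetModel μ X χ) : IsMaxStable μ X := by
  intro m t
  have hX := h.measurable
  -- The value `1` at `n = 0` only serves positivity, which is required at every index.
  refine ⟨fun n _ => if n = 0 then 1 else n, fun _ _ => 0, fun n j => ?_, fun n hn => ?_⟩
  · dsimp only
    split_ifs with h0
    · exact one_pos
    · exact_mod_cast Nat.pos_of_ne_zero h0
  have hn0 : (0 : ℝ) < n := by exact_mod_cast hn
  have hne : n ≠ 0 := by omega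
  simp only [hne, if_false, add_zero]
  have hprob : IsProbabilityMeasure (fdd μ X t) := isProbabilityMeasure_fdd hX t
  have : Nonempty (Fin n) := ⟨⟨0, hn⟩⟩
  have hsup : Measurable fun (y : Fin n → Fin m → ℝ) (j : Fin m) => ⨆ i : Fin n, y i j :=
    measurable_pi_lambda _ fun j => Measurable.iSup fun i =>
      (measurable_pi_apply j).comp (measurable_pi_apply i)
  have haff : Measurable fun (y : Fin m → ℝ) (j : Fin m) => (n : ℝ) * y j := by fun_prop
  have h1 := Measure.isProbabilityMeasure_map (μ := Measure.pi fun _ : Fin n => fdd μ X t)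
    hsup.aemeasurable
  have h2 := Measure.isProbabilityMeasure_map (μ := fdd μ X t) haff.aemeasurable
  have hle : ∀ x : Fin m → ℝ, MeasurableSet {y : Fin m → ℝ | ∀ j, y j ≤ x j} := by
    intro x
    rw [Set.ofPred_forall]
    exact MeasurableSet.iInter fun j => measurableSet_le (measurable_pi_apply j) measurable_const
  refine ext_of_forall_pos_real_forall_le (fun j => ?_) (fun j => ?_) fun x hx => ?_
  · have := map_iSup_pi_real_forall_le hX t n hn (μ := μ) {j} fun _ => 0
    simp only [Set.mem_singleton_iff, forall_eq] at this
    rw [this, h.marginals.real_le_eq_zero (t j) le_rfl, zero_pow hne]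
  · rw [map_measureReal_apply haff (measurableSet_le (measurable_pi_apply j) measurable_const)]
    have hpre : (fun (y : Fin m → ℝ) (j : Fin m) => (n : ℝ) * y j) ⁻¹' {y | y j ≤ 0} =
        {y | y j ≤ 0} := by
      ext y
      simp [mul_nonpos_iff, hn0.not_ge, hn0.le]
    rw [hpre, fdd_real_le_zero hX h.marginals t j]
  · have := map_iSup_pi_real_forall_le hX t n hn (μ := μ) Set.univ x
    simp only [Set.mem_univ, true_imp_iff] at this
    rw [this, map_measureReal_apply haff (hle x)]
    have hpre : (fun (y : Fin m → ℝ) (j : Fin m) => (n : ℝ) * y j) ⁻¹' {y | ∀ j, y j ≤ x j} =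
        {y | ∀ j, y j ≤ x j / n} := by
      ext y
      simp [le_div_iff₀' hn0]
    rw [hpre, fdd_real_forall_le hX, ← h.maxStable m t _ n (fun j => div_pos (hx j) hn0) hn]
    congr 2
    ext j
    field_simp

theorem IsFrechetModel.isTCFOf (h : IsFrechetModel μ X χ) : IsTCFOf μ X χ := by
  intro t
  have hlim := (tendsto_one_sub_exp_div (2 - χ t)).const_sub 2
  rw [sub_sub_cancel] at hlim
  refine hlim.congr' ?_
  filter_upwards [eventually_gt_atTop 0] with τ hτ
  rw [cond_real_eq h.measurable h.marginals t hτ, h.tail t τ hτ]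

end ModelToTCF

/-- Trades the tail limit and equalities of laws for equations at positive levels, which survive
both pointwise limits and weighted maxima. -/
theorem isTCF_iff {d : ℕ} {χ : EuclideanSpace ℝ (Fin d) → ℝ} :
    IsTCF d χ ↔ ∃ (Ω : Type) (_ : MeasurableSpace Ω) (μ : Measure Ω)
      (X : EuclideanSpace ℝ (Fin d) → Ω → ℝ), IsProbabilityMeasure μ ∧ IsFrechetModel μ X χ := by
  constructor
  · rintro ⟨Ω, _, μ, X, hμ, hX, hM, hS, hF, hχ⟩
    exact ⟨Ω, _, μ, X, hμ, isFrechetModel_of_isTCFOf hX hM hS hF hχ⟩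
  · rintro ⟨Ω, _, μ, X, hμ, h⟩
    exact ⟨Ω, _, μ, X, hμ, h.measurable, h.isMaxStable, h.isStationary, h.marginals, h.isTCFOf⟩

/-! ### Weak limits of laws on compact products -/

section Compactness

/-- A normalized positive linear functional on `C(K, ℝ)` is the integral with respect to a
probability measure. -/
theorem exists_isProbabilityMeasure_integral_eq {K : Type*} [TopologicalSpace K] [CompactSpace K]
    [T2Space K] [MeasurableSpace K] [BorelSpace K] (Λ : C(K, ℝ) → ℝ)
    (hadd : ∀ f g, Λ (f + g) = Λ f + Λ g) (hsmul : ∀ (c : ℝ) f, Λ (c • f) = c * Λ f)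
    (hmono : ∀ f g, f ≤ g → Λ f ≤ Λ g) (hone : Λ 1 = 1) :
    ∃ ν : Measure K, IsProbabilityMeasure ν ∧ ∀ f : C(K, ℝ), ∫ y, f y ∂ν = Λ f := by
  let Λ' : CompactlySupportedContinuousMap K ℝ →ₚ[ℝ] ℝ :=
    { toFun := fun f => Λ f.toContinuousMap
      map_add' := fun f g => hadd _ _
      map_smul' := fun c f => hsmul c _
      monotone' := fun f g h => hmono _ _ h }
  have hint : ∀ f : C(K, ℝ), ∫ y, f y ∂(RealRMK.rieszMeasure Λ') = Λ f := fun f =>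
    RealRMK.integral_rieszMeasure Λ' (CompactlySupportedContinuousMap.continuousMapEquiv f)
  refine ⟨RealRMK.rieszMeasure Λ', ⟨?_⟩, hint⟩
  have h1 := hint 1
  simp only [ContinuousMap.one_apply, integral_const, smul_eq_mul, mul_one, hone] at h1
  rwa [measureReal_def, ENNReal.toReal_eq_one_iff] at h1

variable {T S : Type*} [TopologicalSpace S] [CompactSpace S] [T2Space S] [MeasurableSpace S]
  [BorelSpace S]

/-- Real-valued continuous functions on a product of compact Hausdorff spaces are measurable with
respect to the product `σ`-algebra. -/
theorem measurable_of_continuous_pi (f : C(T → S, ℝ)) : Measurable f := by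
  -- For uncountable `T` the product `σ`-algebra can be smaller than the Borel one.
  -- Stone–Weierstrass bridges the gap: functions of one coordinate separate points, so `A` is
  -- uniformly dense.
  let A : Subalgebra ℝ C(T → S, ℝ) :=
    { carrier := {f | Measurable f}
      mul_mem' := fun hf hg => Measurable.mul hf hg
      add_mem' := fun hf hg => Measurable.add hf hg
      algebraMap_mem' := fun r => measurable_const }
  have hsep : A.SeparatesPoints := by
    intro y z hyz
    obtain ⟨t, ht⟩ := Function.ne_iff.mp hyz
    obtain ⟨g, hg0, hg1, -⟩ := exists_continuous_zero_one_of_isClosed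
      (isClosed_singleton (x := y t)) (isClosed_singleton (x := z t)) (by simpa using ht)
    refine ⟨_, ⟨g.comp ⟨fun y => y t, continuous_apply t⟩,
      g.continuous.measurable.comp (measurable_pi_apply t), rfl⟩, ?_⟩
    have h0 : g (y t) = 0 := hg0 rfl
    have h1 : g (z t) = 1 := hg1 rfl
    simp [h0, h1]
  have hmem : f ∈ A.topologicalClosure := by
    rw [ContinuousMap.subalgebra_topologicalClosure_eq_top_of_separatesPoints A hsep]
    trivial
  obtain ⟨u, hu, hlim⟩ := mem_closure_iff_seq_limit.mp hmem
  refine measurable_of_tendsto_metrizable (f := fun n => u n) (fun n => hu n) ?_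
  rw [tendsto_pi_nhds]
  intro y
  exact ((ContinuousEvalConst.continuous_eval_const y).tendsto f).comp hlim

theorem integrable_of_continuous_pi (P : Measure (T → S)) [IsFiniteMeasure P]
    (f : C(T → S, ℝ)) : Integrable f P :=
  Integrable.of_bound (measurable_of_continuous_pi f).aestronglyMeasurable ‖f‖
    (ae_of_all _ f.norm_coe_le_norm)

/-- Along an ultrafilter, the laws of processes with compact state space converge weakly. -/
theorem exists_tendsto_integral_ultrafilter {ι : Type*} (U : Ultrafilter ι)
    (P : ι → Measure (T → S)) (hP : ∀ i, IsProbabilityMeasure (P i)) :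
    ∃ Q : Measure (T → S), IsProbabilityMeasure Q ∧
      ∀ f : C(T → S, ℝ), Tendsto (fun i => ∫ y, f y ∂(P i)) U (𝓝 (∫ y, f y ∂Q)) := by
  have hlim : ∀ f : C(T → S, ℝ), ∃ c : ℝ, Tendsto (fun i => ∫ y, f y ∂(P i)) U (𝓝 c) := by
    intro f
    have hmem : ∀ i, ∫ y, f y ∂(P i) ∈ Metric.closedBall (0 : ℝ) ‖f‖ := by
      intro i
      rw [mem_closedBall_zero_iff]
      simpa using norm_integral_le_of_norm_le_const (μ := P i) (ae_of_all _ f.norm_coe_le_norm)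
    obtain ⟨c, -, hc⟩ := (isCompact_closedBall (0 : ℝ) ‖f‖).ultrafilter_le_nhds
      (U.map fun i => ∫ y, f y ∂(P i)) (by
        rw [le_principal_iff]
        exact Eventually.of_forall (f := (U : Filter ι)) hmem)
    exact ⟨c, hc⟩
  choose Λ hΛ using hlim
  -- Riesz yields a measure on the Borel `σ`-algebra of the product, which is afterwards restricted
  -- to the product `σ`-algebra.
  obtain ⟨ν, hν, hint⟩ := @exists_isProbabilityMeasure_integral_eq (T → S) _ _ _ (borel _)
    (@BorelSpace.mk _ _ (borel _) rfl) Λ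
    (fun f g => tendsto_nhds_unique (hΛ (f + g)) (((hΛ f).add (hΛ g)).congr fun i =>
      (integral_add (integrable_of_continuous_pi _ f) (integrable_of_continuous_pi _ g)).symm))
    (fun c f => tendsto_nhds_unique (hΛ (c • f)) (((hΛ f).const_mul c).congr fun i =>
      (integral_const_mul c _).symm))
    (fun f g h => le_of_tendsto_of_tendsto' (hΛ f) (hΛ g) fun i =>
      integral_mono (integrable_of_continuous_pi _ f) (integrable_of_continuous_pi _ g) h)
    (tendsto_nhds_unique (hΛ 1) (by simp))
  have hle : (MeasurableSpace.pi : MeasurableSpace (T → S)) ≤ borel (T → S) := by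
    refine iSup_le fun t => ?_
    rw [BorelSpace.measurable_eq (α := S)]
    exact (continuous_apply t).borel_measurable.comap_le
  refine ⟨ν.trim hle, ⟨by rw [trim_measurableSet_eq hle MeasurableSet.univ]; exact hν.measure_univ⟩,
    fun f => ?_⟩
  rw [← integral_trim hle (measurable_of_continuous_pi f).stronglyMeasurable, hint]
  exact hΛ f

end Compactness

/-! ### Weak limits with Fréchet marginals -/

section FrechetLimit

variable {T ι : Type*} {U : Ultrafilter ι} {P : ι → Measure (T → EReal)} {Q : Measure (T → EReal)}

/-- Weak convergence of processes with standard Fréchet marginals entails convergence of the joint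
distribution functions on the positive orthant. -/
theorem tendsto_real_forall_le [IsProbabilityMeasure Q] (hP : ∀ i, IsProbabilityMeasure (P i))
    (hF : ∀ i t (x : ℝ), 0 < x → (P i).real {y | y t ≤ (x : EReal)} = Real.exp (-(1 / x)))
    (hlim : ∀ f : C(T → EReal, ℝ), Tendsto (fun i => ∫ y, f y ∂(P i)) U (𝓝 (∫ y, f y ∂Q)))
    {m : ℕ} (t : Fin m → T) (x : Fin m → ℝ) (hx : ∀ j, 0 < x j) :
    Tendsto (fun i => (P i).real {y | ∀ j, y (t j) ≤ (x j : EReal)}) U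
      (𝓝 (Q.real {y | ∀ j, y (t j) ≤ (x j : EReal)})) := by
  let π : (T → EReal) → (Fin m → EReal) := fun y j => y (t j)
  have hπ : Measurable π := measurable_pi_lambda _ fun j => measurable_pi_apply _
  have hπc : Continuous π := by fun_prop
  let Pm : ι → ProbabilityMeasure (Fin m → EReal) := fun i =>
    ⟨(P i).map π, Measure.isProbabilityMeasure_map hπ.aemeasurable⟩
  let Qm : ProbabilityMeasure (Fin m → EReal) :=
    ⟨Q.map π, Measure.isProbabilityMeasure_map hπ.aemeasurable⟩
  have hweak : Tendsto Pm U (𝓝 Qm) := by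
    rw [ProbabilityMeasure.tendsto_iff_forall_integral_tendsto]
    intro f
    have hf : ∀ R : Measure (T → EReal), ∫ z, f z ∂(R.map π) = ∫ y, f (π y) ∂(R) := fun R =>
      integral_map hπ.aemeasurable f.continuous.measurable.aestronglyMeasurable
    simp only [Pm, Qm, ProbabilityMeasure.coe_mk, hf]
    exact hlim ⟨fun y => f (π y), f.continuous.comp hπc⟩
  have hPm : ∀ i, ∀ s, MeasurableSet s → (Pm i : Measure (Fin m → EReal)) s = P i (π ⁻¹' s) :=
    fun i s hs => Measure.map_apply hπ hs
  have hQm : ∀ s, MeasurableSet s → (Qm : Measure (Fin m → EReal)) s = Q (π ⁻¹' s) :=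
    fun s hs => Measure.map_apply hπ hs
  set s : Set (Fin m → EReal) := {z | ∀ j, z j ≤ (x j : EReal)} with hs
  have hsc : IsClosed s := by
    rw [hs, Set.ofPred_forall]
    exact isClosed_iInter fun j => isClosed_le (continuous_apply j) continuous_const
  -- By portmanteau, an open slab of half-width `ε` around the hyperplane has limit mass at most the
  -- Fréchet bound common to all `P i`, and this vanishes with `ε`.
  have hatom : ∀ j, (Qm : Measure (Fin m → EReal)) {z | z j = (x j : EReal)} = 0 := by
    intro j
    have hbound : ∀ ε : ℝ, 0 < ε → ε < x j →
        (Qm : Measure (Fin m → EReal)) {z | z j = (x j : EReal)} ≤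
          ENNReal.ofReal (Real.exp (-(1 / (x j + ε))) - Real.exp (-(1 / (x j - ε)))) := by
      intro ε hε hεx
      set G : Set (Fin m → EReal) :=
        {z | ((x j - ε : ℝ) : EReal) < z j ∧ z j < ((x j + ε : ℝ) : EReal)} with hG
      have hGo : IsOpen G := (isOpen_lt continuous_const (continuous_apply j)).inter
        (isOpen_lt (continuous_apply j) continuous_const)
      refine (measure_mono (t := G) fun z hz => ?_).trans
        ((ProbabilityMeasure.le_liminf_measure_open_of_tendsto hweak hGo).trans ?_)
      · have hz' : z j = (x j : EReal) := hz
        refine ⟨?_, ?_⟩ <;> rw [hz', EReal.coe_lt_coe_iff] <;> linarith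
      · refine (liminf_le_liminf (v := fun _ => ENNReal.ofReal
          (Real.exp (-(1 / (x j + ε))) - Real.exp (-(1 / (x j - ε)))))
          (Eventually.of_forall fun i => ?_)).trans (liminf_const _).le
        rw [hPm i G hGo.measurableSet, ← hF i (t j) _ (by linarith), ← hF i (t j) _ (by linarith),
          ← measureReal_sdiff, ofReal_measureReal]
        · refine measure_mono fun y hy => ⟨hy.2.le, not_le.mpr hy.1⟩
        · intro y (hy : y (t j) ≤ _)
          exact hy.trans (EReal.coe_le_coe_iff.mpr (by linarith))
        · exact measurableSet_le (measurable_pi_apply _) measurable_const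
    have hlim0 : Tendsto (fun ε : ℝ => ENNReal.ofReal
        (Real.exp (-(1 / (x j + ε))) - Real.exp (-(1 / (x j - ε))))) (𝓝[>] 0) (𝓝 0) := by
      have hc : ContinuousAt (fun ε : ℝ =>
          Real.exp (-(1 / (x j + ε))) - Real.exp (-(1 / (x j - ε)))) 0 := by
        have h1 : x j + 0 ≠ 0 := by simpa using (hx j).ne'
        have h2 : x j - 0 ≠ 0 := by simpa using (hx j).ne'
        fun_prop (disch := assumption)
      have := ENNReal.tendsto_ofReal (hc.tendsto.mono_left (nhdsWithin_le_nhds (s := Set.Ioi 0)))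
      simpa using this
    refine le_antisymm (ge_of_tendsto hlim0 ?_) zero_le
    filter_upwards [self_mem_nhdsWithin, mem_nhdsWithin_of_mem_nhds (gt_mem_nhds (hx j))]
      with ε hε hεx using hbound ε hε hεx
  have hfr : (Qm : Measure (Fin m → EReal)) (frontier s) = 0 := by
    refine measure_mono_null (t := ⋃ j, {z | z j = (x j : EReal)}) ?_
      (measure_iUnion_null hatom)
    intro z hz
    rw [hsc.frontier_eq] at hz
    by_contra hne
    simp only [Set.mem_iUnion, not_exists] at hne
    refine hz.2 (mem_interior.mpr ⟨{z | ∀ j, z j < (x j : EReal)}, fun z hz j => (hz j).le, ?_,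
      fun j => lt_of_le_of_ne (hz.1 j) (hne j)⟩)
    rw [Set.ofPred_forall]
    exact isOpen_iInter_of_finite fun j => isOpen_lt (continuous_apply j) continuous_const
  have key := ProbabilityMeasure.tendsto_measure_of_null_frontier_of_tendsto' hweak hfr
  simp only [hPm _ s hsc.measurableSet, hQm s hsc.measurableSet] at key
  exact (ENNReal.tendsto_toReal (measure_ne_top _ _)).comp key

/-- A process with standard Fréchet marginals is almost surely finite. -/
theorem measure_eq_top_eq_zero [IsProbabilityMeasure Q]
    (hF : ∀ t (x : ℝ), 0 < x → Q.real {y | y t ≤ (x : EReal)} = Real.exp (-(1 / x))) (t : T) :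
    Q {y | y t = ⊤} = 0 := by
  rw [← measureReal_eq_zero_iff]
  refine le_antisymm ?_ measureReal_nonneg
  have hlim : Tendsto (fun x : ℝ => 1 - Real.exp (-(1 / x))) atTop (𝓝 0) := by
    have h1 : Tendsto (fun x : ℝ => -(1 / x)) atTop (𝓝 0) := by
      simpa using (tendsto_inv_atTop_zero (𝕜 := ℝ)).neg
    simpa using ((Real.continuous_exp.tendsto 0).comp h1).const_sub 1
  refine ge_of_tendsto hlim ?_
  filter_upwards [eventually_gt_atTop 0] with x hx
  rw [← hF t x hx, ← probReal_compl_eq_one_sub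
    (measurableSet_le (measurable_pi_apply t) measurable_const)]
  refine measureReal_mono fun y (hy : y t = ⊤) => ?_
  change ¬ y t ≤ (x : EReal)
  simp [hy]

end FrechetLimit

/-! ### Closedness and convexity of the set of TCFs -/

section Closure

/-- Tail correlation functions are closed under pointwise limits. -/
theorem isClosed_setOf_isTCF (d : ℕ) : IsClosed {χ | IsTCF d χ} := by
  refine isClosed_of_closure_subset fun χ hχ => ?_
  have hne : (comap ((↑) : {χ | IsTCF d χ} → _) (𝓝 χ)).NeBot :=
    mem_closure_iff_comap_neBot.mp hχ
  -- The index set is the set of TCFs itself, so the inclusion map converges to `χ` along `U`.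
  let U : Ultrafilter {χ | IsTCF d χ} := Ultrafilter.of (comap (↑) (𝓝 χ))
  have hU : Tendsto ((↑) : {χ | IsTCF d χ} → EuclideanSpace ℝ (Fin d) → ℝ) U (𝓝 χ) :=
    tendsto_comap.mono_left (Ultrafilter.of_le _)
  choose Ω mΩ μ X hμ hX using fun i : {χ | IsTCF d χ} => isTCF_iff.mp i.2
  let e : ∀ i, Ω i → EuclideanSpace ℝ (Fin d) → EReal := fun i ω t => (X i t ω : EReal)
  have he : ∀ i, Measurable (e i) := fun i =>
    measurable_pi_lambda _ fun t => ((hX i).measurable t).coe_real_ereal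
  let P : {χ | IsTCF d χ} → Measure (EuclideanSpace ℝ (Fin d) → EReal) := fun i => (μ i).map (e i)
  have hP : ∀ i, IsProbabilityMeasure (P i) := fun i =>
    Measure.isProbabilityMeasure_map (he i).aemeasurable
  have hms : ∀ {m : ℕ} (t : Fin m → EuclideanSpace ℝ (Fin d)) (x : Fin m → ℝ),
      MeasurableSet {y : EuclideanSpace ℝ (Fin d) → EReal | ∀ j, y (t j) ≤ (x j : EReal)} := by
    intro m t x
    rw [Set.ofPred_forall]
    exact MeasurableSet.iInter fun j => measurableSet_le (measurable_pi_apply _) measurable_const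
  have hPcdf : ∀ i {m : ℕ} (t : Fin m → EuclideanSpace ℝ (Fin d)) (x : Fin m → ℝ),
      (P i).real {y | ∀ j, y (t j) ≤ (x j : EReal)} = jointCdf (μ i) (X i) t x := by
    intro i m t x
    rw [map_measureReal_apply (he i) (hms t x), jointCdf]
    congr 1
    ext ω
    simp [e]
  have hPF : ∀ i t (x : ℝ), 0 < x →
      (P i).real {y | y t ≤ (x : EReal)} = Real.exp (-(1 / x)) := by
    intro i t x hx
    have := hPcdf i ![t] fun _ => x
    rw [jointCdf_singleton, (hX i).marginals t x hx] at this
    rw [← this]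
    simp
  obtain ⟨Q, hQ, hlim⟩ := exists_tendsto_integral_ultrafilter U P hP
  have hcdf' : ∀ {m : ℕ} (t : Fin m → EuclideanSpace ℝ (Fin d)) (x : Fin m → ℝ), (∀ j, 0 < x j) →
      Tendsto (fun i => jointCdf (μ i) (X i) t x) U
        (𝓝 (Q.real {y | ∀ j, y (t j) ≤ (x j : EReal)})) := by
    intro m t x hx
    simpa only [hPcdf] using tendsto_real_forall_le hP hPF hlim t x hx
  have hQF : ∀ t (x : ℝ), 0 < x → Q.real {y | y t ≤ (x : EReal)} = Real.exp (-(1 / x)) := by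
    intro t x hx
    have := hcdf' ![t] (fun _ => x) fun _ => hx
    simp only [jointCdf_singleton, (hX _).marginals t x hx] at this
    simpa using tendsto_nhds_unique this tendsto_const_nhds
  -- `toReal` sends both infinities to `0`. This is harmless for `⊥`, as only levels `x > 0` are
  -- tested, and for `⊤`, which has probability zero at each point.
  let Y : EuclideanSpace ℝ (Fin d) → (EuclideanSpace ℝ (Fin d) → EReal) → ℝ :=
    fun t y => (y t).toReal
  have hcdf : ∀ {m : ℕ} (t : Fin m → EuclideanSpace ℝ (Fin d)) (x : Fin m → ℝ), (∀ j, 0 < x j) →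
      Tendsto (fun i => jointCdf (μ i) (X i) t x) U (𝓝 (jointCdf Q Y t x)) := by
    intro m t x hx
    convert hcdf' t x hx using 2
    refine measureReal_congr ?_
    have hfin : ∀ᵐ y ∂Q, ∀ j, y (t j) ≠ ⊤ :=
      ae_all_iff.mpr fun j => measure_eq_zero_iff_ae_notMem.mp (measure_eq_top_eq_zero hQF (t j))
    filter_upwards [hfin] with y hy
    refine propext (forall_congr' fun j => ?_)
    induction h : y (t j) with
    | bot => simp [Y, h, (hx j).le]
    | top => exact absurd h (hy j)
    | coe r => simp [Y, h]
  refine isTCF_iff.mpr ⟨_, _, Q, Y, hQ, ?_⟩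
  constructor
  · exact fun t => (measurable_pi_apply t).ereal_toReal
  · intro t x hx
    have := hcdf ![t] (fun _ => x) fun _ => hx
    simp only [jointCdf_singleton, (hX _).marginals t x hx] at this
    exact tendsto_nhds_unique this tendsto_const_nhds
  · intro m t h x hx
    refine tendsto_nhds_unique (hcdf _ x hx) ((hcdf t x hx).congr fun i => ?_)
    exact ((hX i).stationary m t h x hx).symm
  · intro m t x n hx hn
    have hn0 : (0 : ℝ) < n := by exact_mod_cast hn
    refine tendsto_nhds_unique ((hcdf t _ fun j => mul_pos hn0 (hx j)).pow n)
      ((hcdf t x hx).congr fun i => ?_)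
    exact ((hX i).maxStable m t x n hx hn).symm
  · intro t x hx
    have h1 := hcdf ![0, t] (fun _ => x) fun _ => hx
    simp only [(hX _).tail t x hx] at h1
    refine tendsto_nhds_unique h1 ?_
    exact (Real.continuous_exp.tendsto _).comp
      ((((tendsto_pi_nhds.mp hU t).const_sub 2).div_const x).neg)

/-- Tail correlation functions form a convex set. -/
theorem convex_setOf_isTCF (d : ℕ) : Convex ℝ {χ | IsTCF d χ} := by
  refine convex_iff_forall_pos.mpr fun χ hχ χ' hχ' a b ha hb hab => ?_
  obtain ⟨Ω, _, μ, X, hμ, hX⟩ := isTCF_iff.mp hχ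
  obtain ⟨Ω', _, μ', X', hμ', hX'⟩ := isTCF_iff.mp hχ'
  -- Independence multiplies the distribution functions, and `a (2 - χ) + b (2 - χ') = 2 - (a χ + b
  -- χ')` because `a + b = 1`.
  let Z : EuclideanSpace ℝ (Fin d) → Ω × Ω' → ℝ := fun t ω => max (a * X t ω.1) (b * X' t ω.2)
  have hZ : ∀ {m : ℕ} (t : Fin m → EuclideanSpace ℝ (Fin d)) (x : Fin m → ℝ),
      jointCdf (μ.prod μ') Z t x =
        jointCdf μ X t (fun j => x j / a) * jointCdf μ' X' t (fun j => x j / b) := by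
    intro m t x
    rw [jointCdf, jointCdf, jointCdf, ← measureReal_prod_prod]
    congr 1
    ext ω
    simp [Z, le_div_iff₀' ha, le_div_iff₀' hb, forall_and]
  refine isTCF_iff.mpr ⟨Ω × Ω', inferInstance, μ.prod μ', Z, inferInstance, ?_⟩
  have hXm := hX.measurable
  have hXm' := hX'.measurable
  constructor
  · intro t
    exact (((hXm t).comp measurable_fst).const_mul a).max
      (((hXm' t).comp measurable_snd).const_mul b)
  · intro t x hx
    have := hZ ![t] fun _ => x
    rw [jointCdf_singleton, jointCdf_singleton, jointCdf_singleton,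
      hX.marginals t _ (div_pos hx ha), hX'.marginals t _ (div_pos hx hb), ← Real.exp_add] at this
    rw [this]
    congr 1
    field_simp
    linarith
  · intro m t h x hx
    rw [hZ, hZ, hX.stationary m t h _ fun j => div_pos (hx j) ha,
      hX'.stationary m t h _ fun j => div_pos (hx j) hb]
  · intro m t x n hx hn
    rw [hZ, hZ, mul_pow, ← hX.maxStable m t _ n (fun j => div_pos (hx j) ha) hn,
      ← hX'.maxStable m t _ n (fun j => div_pos (hx j) hb) hn]
    simp only [mul_div_assoc]
  · intro t x hx
    rw [hZ, hX.tail t _ (div_pos hx ha), hX'.tail t _ (div_pos hx hb), ← Real.exp_add]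
    congr 1
    simp only [Pi.add_apply, Pi.smul_apply, smul_eq_mul]
    field_simp
    linear_combination (-2 : ℝ) * hab

end Closure

/-! ### The turning bands operator as an average -/

section TurningBands

variable {k d : ℕ}

theorem transposeApply_zero (A : Matrix (Fin d) (Fin k) ℝ) : transposeApply A 0 = 0 := by
  simp [transposeApply]

theorem transposeApply_add (A : Matrix (Fin d) (Fin k) ℝ) (s t : EuclideanSpace ℝ (Fin d)) :
    transposeApply A (s + t) = transposeApply A s + transposeApply A t := by
  simp [transposeApply, Matrix.mulVec_add]

theorem continuous_transposeApply :
    Continuous fun p : Matrix (Fin d) (Fin k) ℝ × EuclideanSpace ℝ (Fin d) =>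
      transposeApply p.1 p.2 := by
  unfold transposeApply
  refine (PiLp.continuous_toLp 2 _).comp ?_
  exact (continuous_fst.matrix_transpose).matrix_mulVec
    ((PiLp.continuous_ofLp 2 _).comp continuous_snd)

/-- Tail correlation functions are stable under composition with linear maps. -/
theorem IsTCF.comp_transposeApply {χ : EuclideanSpace ℝ (Fin k) → ℝ} (hχ : IsTCF k χ)
    (A : Matrix (Fin d) (Fin k) ℝ) : IsTCF d fun t => χ (transposeApply A t) := by
  obtain ⟨Ω, _, μ, X, hμ, hX, hM, hS, hF, hT⟩ := hχ
  refine ⟨Ω, _, μ, fun t => X (transposeApply A t), hμ, fun t => hX _,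
    fun m t => hM m fun j => transposeApply A (t j), fun m t h => ?_, fun t => hF _, fun t => ?_⟩
  · have := hS m (fun j => transposeApply A (t j)) (transposeApply A h)
    simpa only [fdd, transposeApply_add] using this
  · simpa only [transposeApply_zero] using hT (transposeApply A t)

/-- Limits of conditional probabilities stay in `[0, 1]`; the bound provides integrability and
domination over the Stiefel manifold. -/
theorem IsTCF.norm_le_one {χ : EuclideanSpace ℝ (Fin d) → ℝ} (hχ : IsTCF d χ)
    (t : EuclideanSpace ℝ (Fin d)) : ‖χ t‖ ≤ 1 := by
  obtain ⟨Ω, _, μ, X, hμ, hX, hM, hS, hF, hT⟩ := hχ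
  refine le_of_tendsto (hT t).norm (Eventually.of_forall fun τ => ?_)
  rw [Real.norm_of_nonneg measureReal_nonneg]
  by_cases h : μ {ω | τ ≤ X 0 ω} = 0
  · simp [ProbabilityTheory.cond_eq_zero_of_meas_eq_zero h]
  · have := ProbabilityTheory.cond_isProbabilityMeasure h
    exact measureReal_le_one

theorem continuous_comp_transposeApply {χ : EuclideanSpace ℝ (Fin k) → ℝ} (hχ : Continuous χ)
    (t : EuclideanSpace ℝ (Fin d)) :
    Continuous fun A : Stiefel k d => χ (transposeApply (A : Matrix (Fin d) (Fin k) ℝ) t) :=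
  hχ.comp (continuous_transposeApply.comp (continuous_subtype_val.prodMk continuous_const))

instance instBorelSpaceStiefel : BorelSpace (Stiefel k d) := Subtype.borelSpace _

theorem continuous_turningBands (hkd : k ≤ d) {χ : EuclideanSpace ℝ (Fin k) → ℝ}
    (hχc : Continuous χ) {C : ℝ} (hC : ∀ t, ‖χ t‖ ≤ C) : Continuous (turningBands hkd χ) := by
  refine continuous_of_dominated (bound := fun _ => C) (fun t => ?_)
    (fun t => ae_of_all _ fun A => hC _) (integrable_const _) (ae_of_all _ fun A => ?_)
  · exact (continuous_comp_transposeApply hχc t).aestronglyMeasurable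
  · exact hχc.comp (continuous_transposeApply.comp (continuous_const.prodMk continuous_id))

/-- The turning bands operator lies in the pointwise closure of every convex set containing all
the functions `t ↦ χ (Aᵀ t)`. -/
theorem turningBands_mem_closure (hkd : k ≤ d) {χ : EuclideanSpace ℝ (Fin k) → ℝ}
    (hχc : Continuous χ) {C : ℝ} (hC : ∀ t, ‖χ t‖ ≤ C)
    {K : Set (EuclideanSpace ℝ (Fin d) → ℝ)} (hK : Convex ℝ K)
    (hmem : ∀ A : Stiefel k d, (fun t => χ (transposeApply (A : Matrix (Fin d) (Fin k) ℝ) t)) ∈ K) :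
    turningBands hkd χ ∈ closure K := by
  rw [mem_closure_iff_nhds]
  intro V hV
  rw [nhds_pi, Filter.mem_pi] at hV
  -- A neighbourhood for pointwise convergence constrains finitely many points `I`, which reduces
  -- the claim to `I → ℝ`. There the mean of a probability measure carried by a closed convex set
  -- lies in that set.
  obtain ⟨I, hI, s, hs, hsV⟩ := hV
  have := hI.fintype
  let r : (EuclideanSpace ℝ (Fin d) → ℝ) →ₗ[ℝ] (I → ℝ) := LinearMap.funLeft ℝ ℝ (↑)
  let g : Stiefel k d → I → ℝ := fun A =>
    r fun t => χ (transposeApply (A : Matrix (Fin d) (Fin k) ℝ) t)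
  have hgc : Continuous g := continuous_pi fun t => continuous_comp_transposeApply hχc t.1
  have hgi : Integrable g (stiefelUniform hkd) := by
    refine Integrable.of_bound hgc.aestronglyMeasurable (max C 0) (ae_of_all _ fun A => ?_)
    exact (pi_norm_le_iff_of_nonneg (le_max_right _ _)).mpr fun t => (hC _).trans (le_max_left _ _)
  have hint : ∫ A, g A ∂(stiefelUniform hkd) = r (turningBands hkd χ) := by
    ext t
    exact eval_integral (fun t => hgi.eval t) t
  have hcl : r (turningBands hkd χ) ∈ closure (r '' K) := by
    rw [← hint]
    exact (hK.linear_image r).closure.integral_mem isClosed_closure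
      (ae_of_all _ fun A => subset_closure ⟨_, hmem A, rfl⟩) hgi
  have hnhds : Set.univ.pi (fun t : I => s t) ∈ 𝓝 (r (turningBands hkd χ)) :=
    set_pi_mem_nhds Set.finite_univ fun t _ => hs t
  obtain ⟨_, hf, f, hfK, rfl⟩ := mem_closure_iff_nhds.mp hcl _ hnhds
  exact ⟨f, hsV fun t ht => hf ⟨t, ht⟩ trivial, hfK⟩

end TurningBands

end TailCorrelation

theorem proposition4p3 (k d : ℕ) (hk : 1 ≤ k) (hkd : k ≤ d)
    (χ : EuclideanSpace ℝ (Fin k) → ℝ) (hχc : Continuous χ)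
    (hχ : TailCorrelation.IsTCF k χ) :
    Continuous (TailCorrelation.turningBands hkd χ) ∧
      TailCorrelation.IsTCF d (TailCorrelation.turningBands hkd χ) := by
  refine ⟨TailCorrelation.continuous_turningBands hkd hχc hχ.norm_le_one, ?_⟩
  have h := TailCorrelation.turningBands_mem_closure hkd hχc hχ.norm_le_one
    (TailCorrelation.convex_setOf_isTCF d) fun A => hχ.comp_transposeApply _
  rwa [(TailCorrelation.isClosed_setOf_isTCF d).closure_eq] at h
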